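/- Let $n\ge 1$, let $\mathcal D\subseteq\mathbb R^p$ be convex and compact, and let $f_1,\dots,f_n:\mathbb R^p\to\mathbb R$ be convex and $L$-smooth (differentiable with $L$-Lipschitz gradient). Put $F(x)=\frac1n\sum_{i=1}^n f_i(x)$ and let $x^*\in\mathcal D$ minimize $F$ over $\mathcal D$. Let $\sigma\in\mathbb R$, $\lambda_0>0$, and let $x_1^1,\dots,x_n^1\in\mathbb R^p$ be deterministic initial points. Then there is a constant $C$, which depends only on these data, such that the following holds. Suppose that each client loss is an expectation $f_i(x)=\mathbb E_{\omega_i\sim\mathcal P_i}[f_i(x,\omega_i)]$ over a probability law $\mathcal P_i$, that for every $x$ the function $f_i(\cdot,\omega_i)$ is differentiable at $x$ for almost every $\omega_i$, that the stochastic gradients $\nabla f_i(x,\omega_i)$ (gradients in $x$; jointly measurable in $(x,\omega_i)$) are unbiased, $\mathbb E_{\omega_i}[\nabla f_i(x,\omega_i)]=\nabla f_i(x)$, and that they have bounded variance, $\mathbb E_{\omega_i}\big[\|\nabla f_i(x,\omega_i)-\nabla f_i(x)\|^2\big]\le\sigma^2$, for all $x\in\mathbb R^p$ and all $i$. Run FedFW-sto: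 set $\bar x^1=\frac1n\sum_i x_i^1$ and $d_i^1=0$, and for $t=1,2,\dots$ and every $i$ draw a sample $\omega_i^t\sim\mathcal P_i$ independently of the past (all that happened before round $t$) and set $$d_i^{t+1}=(1-\rho_t)d_i^t+\rho_t\tfrac1n\nabla f_i(x_i^t,\omega_i^t),\qquad g_i^t=d_i^{t+1}+\lambda_t(x_i^t-\bar x^t),\qquad s_i^t\in\operatorname*{arg\,min}_{x\in\mathcal D}\langle g_i^t,x\rangle,$$ $$x_i^{t+1}=(1-\eta_t)x_i^t+\eta_t s_i^t,\qquad \bar x^{t+1}=(1-\eta_t)\bar x^t+\eta_t\,\tfrac1n\sum_{i=1}^n s_i^t,$$ with $\eta_t=\frac{9}{t+8}$, $\lambda_t=\lambda_0\sqrt{t+8}$ and $\rho_t=\frac{4}{(t+7)^{2/3}}$, where the choice of $s_i^t$ among several minimizers is measurable and does not use samples of later rounds. Then, for all $t\ge1$, $F(\bar x^t)$ is integrable and $$\mathbb E[F(\bar x^t)]-F(x^*)\le C\,t^{-1/3}.$$ -/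

import Mathlib

open MeasureTheory ProbabilityTheory

/-- A function is `L`-smooth when it is differentiable and its gradient is `L`-Lipschitz. -/
structure LSmooth {p : ℕ} (L : NNReal) (f : EuclideanSpace ℝ (Fin p) → ℝ) : Prop where
  differentiable : Differentiable ℝ f
  lipschitz : LipschitzWith L (gradient f)

/-- The objective `F(x) = (1/n) ∑ᵢ fᵢ(x)`. -/
noncomputable def globalLoss {p n : ℕ} (f : Fin n → EuclideanSpace ℝ (Fin p) → ℝ)
    (x : EuclideanSpace ℝ (Fin p)) : ℝ :=
  (1 / (n : ℝ)) * ∑ i, f i x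

/-- The stochastic gradient `∇f(x, ω)` of a sample loss `ℓ(x, ω)`; the gradient is with respect
to `x`. -/
noncomputable def stochGrad {p : ℕ} {S : Type*} (ℓ : EuclideanSpace ℝ (Fin p) → S → ℝ)
    (x : EuclideanSpace ℝ (Fin p)) (ω : S) : EuclideanSpace ℝ (Fin p) :=
  gradient (fun y => ℓ y ω) x

/-- The sample loss `ℓ(x, ω)`, with `ω` drawn from the law `P`, represents the client loss
`f(x) = 𝔼[ℓ(x, ω)]`, and its stochastic gradients are unbiased estimators of the gradient
of `f`. -/
structure IsStochasticLoss {p : ℕ} {S : Type*} [MeasurableSpace S]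
    (f : EuclideanSpace ℝ (Fin p) → ℝ) (ℓ : EuclideanSpace ℝ (Fin p) → S → ℝ)
    (P : Measure S) : Prop where
  isProbabilityMeasure : IsProbabilityMeasure P
  integrable : ∀ x, Integrable (ℓ x) P
  expectation : ∀ x, f x = ∫ ω, ℓ x ω ∂P
  differentiableAt : ∀ x, ∀ᵐ ω ∂P, DifferentiableAt ℝ (fun y => ℓ y ω) x
  measurable_grad :
    Measurable (fun q : EuclideanSpace ℝ (Fin p) × S => stochGrad ℓ q.1 q.2)
  integrable_grad : ∀ x, Integrable (stochGrad ℓ x) P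
  unbiased : ∀ x, ∫ ω, stochGrad ℓ x ω ∂P = gradient f x

/-- Bounded variance: `𝔼 ‖∇f(x, ω) - ∇f(x)‖² ≤ σ²` for all `x`. -/
def BoundedVariance {p : ℕ} {S : Type*} [MeasurableSpace S]
    (f : EuclideanSpace ℝ (Fin p) → ℝ) (ℓ : EuclideanSpace ℝ (Fin p) → S → ℝ)
    (P : Measure S) (σ : ℝ) : Prop :=
  ∀ x, Integrable (fun ω => ‖stochGrad ℓ x ω - gradient f x‖ ^ 2) P ∧
    ∫ ω, ‖stochGrad ℓ x ω - gradient f x‖ ^ 2 ∂P ≤ σ ^ 2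

/-- `IsFedFWStoRun D ℓ P η lam ρ x₁ μ ℱ ξ x d g s xbar`: the random sequences `x, d, g, s, xbar`
on the probability space `(Ω, μ)` are generated by FedFW-sto over `D` from the sample losses
`ℓ i` and sample laws `P i`, with step sizes `η t`, penalty parameters `lam t`, averaging weights
`ρ t` and initial local models `x₁ i`.

Rounds are `t = 1, 2, …`; index `0` is not used. `ξ t i` is the sample that client `i` draws in
round `t`. `ℱ t` is the information available at the beginning of round `t`: the samples of
round `t` are independent of it, and the samples and the linear-minimization outputs of round `t`
belong to `ℱ (t + 1)`. So ties in the linear minimization may be broken in any way, even at random,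
that does not look at samples of later rounds. -/
structure IsFedFWStoRun {p n : ℕ} {S : Fin n → Type*} [∀ i, MeasurableSpace (S i)]
    {Ω : Type*} {mΩ : MeasurableSpace Ω}
    (D : Set (EuclideanSpace ℝ (Fin p)))
    (ℓ : (i : Fin n) → EuclideanSpace ℝ (Fin p) → S i → ℝ)
    (P : (i : Fin n) → Measure (S i))
    (η lam ρ : ℕ → ℝ)
    (x₁ : Fin n → EuclideanSpace ℝ (Fin p))
    (μ : Measure Ω) (ℱ : Filtration ℕ mΩ)
    (ξ : ℕ → (i : Fin n) → Ω → S i)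
    (x d g s : ℕ → Fin n → Ω → EuclideanSpace ℝ (Fin p))
    (xbar : ℕ → Ω → EuclideanSpace ℝ (Fin p)) : Prop where
  sample_measurable : ∀ t ≥ 1, ∀ i, Measurable[ℱ (t + 1)] (ξ t i)
  sample_law : ∀ t ≥ 1, ∀ i, Measure.map (ξ t i) μ = P i
  sample_indep : ∀ t ≥ 1, ∀ i, Indep (MeasurableSpace.comap (ξ t i) inferInstance) (ℱ t) μ
  x_init : ∀ i ω, x 1 i ω = x₁ i
  d_init : ∀ i ω, d 1 i ω = 0
  xbar_init : ∀ ω, xbar 1 ω = (1 / (n : ℝ)) • ∑ i, x₁ i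
  d_step : ∀ t ≥ 1, ∀ i ω,
    d (t + 1) i ω =
      (1 - ρ t) • d t i ω + ρ t • ((1 / (n : ℝ)) • stochGrad (ℓ i) (x t i ω) (ξ t i ω))
  g_def : ∀ t ≥ 1, ∀ i ω, g t i ω = d (t + 1) i ω + lam t • (x t i ω - xbar t ω)
  s_mem : ∀ t ≥ 1, ∀ i ω, s t i ω ∈ D
  s_isMinOn : ∀ t ≥ 1, ∀ i ω, IsMinOn (fun y => inner ℝ (g t i ω) y) D (s t i ω)
  s_measurable : ∀ t ≥ 1, ∀ i, Measurable[ℱ (t + 1)] (s t i)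
  x_step : ∀ t ≥ 1, ∀ i ω, x (t + 1) i ω = (1 - η t) • x t i ω + η t • s t i ω
  xbar_step : ∀ t ≥ 1, ∀ ω,
    xbar (t + 1) ω = (1 - η t) • xbar t ω + η t • ((1 / (n : ℝ)) • ∑ i, s t i ω)

/-! The run is Frank–Wolfe with inexact gradients on a penalized objective, the mean of `f i (x i)`
plus `lam / 2 * ∑ i, ‖x i - xbar‖ ^ 2`, whose penalty weight grows with `t`. The potential is
`penalizedGap`, measured against a common point `z ∈ D`.

In one step (`penalized_frankWolfe_step`) convexity contracts the loss part by `1 - η`, while the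
quadratic penalty, which vanishes at a consensus point, contracts by `1 - 2 * η`. The spare factor
pays for the growth of the penalty weight (`sqrt_mul_one_sub_le`). What remains is `η` times the
gradient error, and curvature of order `η² lam ~ t ^ (-3/2)`.

The gradient error is controlled in mean square. Fresh noise is centred given the past, so averaging
adds only `ρ² σ²`, and the movement of the iterates adds order `η² / ρ`. With `ρ ~ t ^ (-2/3)` both
are of order `t ^ (-4/3)`, and the contraction `1 - ρ` yields mean square error `O(t ^ (-2/3))`
(`integral_gradError_sq_le`).

The expected potential thus obeys a recursion with contraction `1 - 9/(t+8)` and perturbation of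
order `t ^ (-4/3)`, hence is at most of order `t ^ (-1/3)` (`le_mul_rpow_of_recursion`). Passing
from the local models to their average costs `O(1/lam) = O(t ^ (-1/2))`
(`globalLoss_sub_le_penalizedGap`). -/

/-! ### Convexity, smoothness and one inexact Frank–Wolfe step. -/

theorem ConvexOn.add_inner_gradient_le {E : Type*} [NormedAddCommGroup E] [InnerProductSpace ℝ E]
    [CompleteSpace E] {f : E → ℝ} (hf : ConvexOn ℝ Set.univ f) {x : E}
    (hd : DifferentiableAt ℝ f x) (y : E) :
    f x + inner ℝ (gradient f x) (y - x) ≤ f y := by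
  have hc : ConvexOn ℝ Set.univ (fun r : ℝ => f (AffineMap.lineMap x y r)) := by
    have h := hf.comp_affineMap (AffineMap.lineMap x y : ℝ →ᵃ[ℝ] E)
    exact h
  have hder : HasDerivAt (fun r : ℝ => f (AffineMap.lineMap x y r))
      (inner ℝ (gradient f x) (y - x)) 0 := by
    have h1 : HasDerivAt (fun r : ℝ => (AffineMap.lineMap x y r : E)) (y - x) 0 :=
      AffineMap.hasDerivAt_lineMap
    have h2 : HasFDerivAt f (fderiv ℝ f x) (AffineMap.lineMap x y (0 : ℝ)) := by
      simpa using hd.hasFDerivAt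
    rw [inner_gradient_left]
    exact h2.comp_hasDerivAt (0 : ℝ) h1
  have h := hc.le_slope_of_hasDerivAt (Set.mem_univ 0) (Set.mem_univ 1) one_pos hder
  simp only [slope_def_field, AffineMap.lineMap_apply_one, AffineMap.lineMap_apply_zero, sub_zero,
    div_one] at h
  linarith

/-- A quadratic upper bound for convex functions with Lipschitz gradient. -/
theorem ConvexOn.le_add_inner_gradient_add {E : Type*} [NormedAddCommGroup E]
    [InnerProductSpace ℝ E] [CompleteSpace E] {f : E → ℝ} (hf : ConvexOn ℝ Set.univ f)
    (hd : Differentiable ℝ f) {L : NNReal} (hL : LipschitzWith L (gradient f)) (x y : E) :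
    f y ≤ f x + inner ℝ (gradient f x) (y - x) + L * ‖y - x‖ ^ 2 := by
  -- The tangent inequality at `y` instead of an integral along the segment; this costs a factor 2
  -- against the usual `L / 2`.
  have h1 := hf.add_inner_gradient_le (hd y) x
  have h2 : inner ℝ (gradient f y - gradient f x) (y - x) ≤ L * ‖y - x‖ ^ 2 := by
    refine (real_inner_le_norm _ _).trans ?_
    have := hL.dist_le_mul y x
    rw [dist_eq_norm, dist_eq_norm] at this
    nlinarith [norm_nonneg (y - x)]
  rw [inner_sub_left] at h2
  have h3 : inner ℝ (gradient f y) (x - y) = - inner ℝ (gradient f y) (y - x) := by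
    rw [← inner_neg_right, neg_sub]
  linarith

/-- One step of the Frank–Wolfe method with inexact gradients `d i` on the consensus-penalized
objective. -/
theorem penalized_frankWolfe_step {E ι : Type*} [NormedAddCommGroup E] [InnerProductSpace ℝ E]
    [CompleteSpace E] [Fintype ι] {f : ι → E → ℝ} (hf : ∀ i, ConvexOn ℝ Set.univ (f i))
    (hd : ∀ i, Differentiable ℝ (f i)) {L : NNReal} (hL : ∀ i, LipschitzWith L (gradient (f i)))
    {c η lam B : ℝ} (hc : 0 ≤ c) (hcn : c * Fintype.card ι = 1) (hη : 0 ≤ η)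
    (hlam : 0 ≤ lam) {x s d : ι → E} {xbar z : E}
    (hxbar : xbar = c • ∑ i, x i) (hx : ∀ i, ‖x i‖ ≤ B) (hs : ∀ i, ‖s i‖ ≤ B) (hz : ‖z‖ ≤ B)
    (hopt : ∀ i, inner ℝ (d i + lam • (x i - xbar)) (s i)
      ≤ inner ℝ (d i + lam • (x i - xbar)) z) :
    c * ∑ i, f i ((1 - η) • x i + η • s i) - c * ∑ i, f i z
      + lam / 2 * ∑ i, ‖((1 - η) • x i + η • s i)
          - ((1 - η) • xbar + η • (c • ∑ i, s i))‖ ^ 2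
    ≤ (1 - η) * (c * ∑ i, f i (x i) - c * ∑ i, f i z)
      + lam / 2 * (1 - 2 * η) * ∑ i, ‖x i - xbar‖ ^ 2
      + η * ∑ i, 2 * B * ‖d i - c • gradient (f i) (x i)‖
      + η ^ 2 * (4 * L * B ^ 2 + 8 * (Fintype.card ι) * lam * B ^ 2) := by
  have hn : (0 : ℝ) < Fintype.card ι := by
    rcases (Nat.cast_nonneg (α := ℝ) (Fintype.card ι)).lt_or_eq with h | h
    · exact h
    · rw [← h] at hcn; simp at hcn
  have havg : ∀ u : ι → E, (∀ i, ‖u i‖ ≤ B) → ‖c • ∑ i, u i‖ ≤ B := by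
    intro u hu
    rw [norm_smul, Real.norm_of_nonneg hc]
    calc c * ‖∑ i, u i‖ ≤ c * ∑ i : ι, B :=
          mul_le_mul_of_nonneg_left (norm_sum_le_of_le _ fun i _ => hu i) hc
      _ = B := by
        rw [Finset.sum_const, Finset.card_univ, nsmul_eq_mul, ← mul_assoc, hcn, one_mul]
  have hB : 0 ≤ B := (norm_nonneg z).trans hz
  have hxb : ‖xbar‖ ≤ B := hxbar ▸ havg x hx
  set sbar := c • ∑ i, s i with hsbar
  have hsb : ‖sbar‖ ≤ B := havg s hs
  have hsum0 : ∑ i, (x i - xbar) = 0 := by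
    rw [Finset.sum_sub_distrib, Finset.sum_const, Finset.card_univ, hxbar, ← Nat.cast_smul_eq_nsmul ℝ,
      smul_smul, mul_comm, hcn, one_smul, sub_self]
  have horth : ∀ v : E, ∑ i, inner ℝ (x i - xbar) v = 0 := by
    intro v
    rw [← sum_inner, hsum0, inner_zero_left]
  -- termwise estimate
  have hterm : ∀ i, c * f i ((1 - η) • x i + η • s i) - c * f i z
      + lam / 2 * ‖((1 - η) • x i + η • s i) - ((1 - η) • xbar + η • sbar)‖ ^ 2
    ≤ (1 - η) * (c * f i (x i) - c * f i z)
      + lam / 2 * (1 - 2 * η) * ‖x i - xbar‖ ^ 2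
      + η * (2 * B * ‖d i - c • gradient (f i) (x i)‖)
      + η ^ 2 * (4 * c * L * B ^ 2 + 8 * lam * B ^ 2)
      + lam * η * inner ℝ (x i - xbar) (z - sbar) := by
    intro i
    set p := x i - xbar
    set q := s i - sbar
    have e1 : ((1 - η) • x i + η • s i) - ((1 - η) • xbar + η • sbar) = p + η • (q - p) := by
      simp only [p, q]; module
    have e2 : ((1 - η) • x i + η • s i) - x i = η • (s i - x i) := by module
    have hsx : ‖s i - x i‖ ≤ 2 * B := (norm_sub_le _ _).trans (by linarith [hs i, hx i])
    have hszn : ‖s i - z‖ ≤ 2 * B := (norm_sub_le _ _).trans (by linarith [hs i])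
    have hqp : ‖q - p‖ ≤ 4 * B := by
      refine (norm_sub_le _ _).trans ?_
      have := norm_sub_le (s i) sbar
      have := norm_sub_le (x i) xbar
      simp only [p, q]
      linarith [hs i, hx i]
    have hdesc := (hf i).le_add_inner_gradient_add (hd i) (hL i) (x i) ((1 - η) • x i + η • s i)
    rw [e2, inner_smul_right, norm_smul, mul_pow, Real.norm_eq_abs, sq_abs] at hdesc
    have hgrad := (hf i).add_inner_gradient_le (hd i (x i)) z
    have hsx2 : ‖s i - x i‖ ^ 2 ≤ 4 * B ^ 2 := by nlinarith [norm_nonneg (s i - x i)]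
    have hqp2 : ‖q - p‖ ^ 2 ≤ 16 * B ^ 2 := by nlinarith [norm_nonneg (q - p)]
    have herr : inner ℝ (c • gradient (f i) (x i) - d i) (s i - z)
        ≤ 2 * B * ‖d i - c • gradient (f i) (x i)‖ := by
      refine (real_inner_le_norm _ _).trans ?_
      rw [norm_sub_rev, mul_comm]
      exact mul_le_mul_of_nonneg_right hszn (norm_nonneg _)
    have ho := hopt i
    have hpq : ‖p + η • (q - p)‖ ^ 2 = ‖p‖ ^ 2 + 2 * η * inner ℝ p (q - p) + η ^ 2 * ‖q - p‖ ^ 2 := by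
      rw [norm_add_sq_real, inner_smul_right, norm_smul, mul_pow, Real.norm_eq_abs, sq_abs]; ring
    -- The first two terms are the penalty part of the optimality inequality at `s i`. The term
    -- `-‖p‖ ^ 2` produces the factor `1 - 2 * η`, and the term with `z - sbar` disappears after
    -- summation over the clients, by `horth`.
    have hqp_inner : inner ℝ p (q - p) = inner ℝ p (s i) - inner ℝ p z
        + inner ℝ p (z - sbar) - ‖p‖ ^ 2 := by
      rw [← real_inner_self_eq_norm_sq, ← inner_sub_right, ← inner_add_right, ← inner_sub_right]
      simp only [q]; congr 1; abel
    rw [inner_add_left, inner_add_left, real_inner_smul_left, real_inner_smul_left] at ho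
    rw [inner_sub_left, inner_sub_right, inner_sub_right, real_inner_smul_left,
      real_inner_smul_left] at herr
    rw [inner_sub_right] at hdesc hgrad
    rw [e1, hpq, hqp_inner]
    have h1 := mul_le_mul_of_nonneg_left hdesc hc
    have h2 := mul_le_mul_of_nonneg_left hgrad (mul_nonneg hc hη)
    have h3 := mul_le_mul_of_nonneg_left hsx2 (mul_nonneg (mul_nonneg hc L.coe_nonneg) (sq_nonneg η))
    have h4 := mul_le_mul_of_nonneg_left hqp2 (mul_nonneg (half_pos one_pos).le (mul_nonneg hlam (sq_nonneg η)))
    have h5 := mul_le_mul_of_nonneg_left herr hη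
    have h6 := mul_le_mul_of_nonneg_left ho hη
    linarith
  have hsum := Finset.sum_le_sum fun i (_ : i ∈ Finset.univ) => hterm i
  simp only [Finset.sum_add_distrib, Finset.sum_sub_distrib, ← Finset.mul_sum, horth,
    Finset.sum_const, Finset.card_univ, nsmul_eq_mul] at hsum ⊢
  have hcL : (Fintype.card ι : ℝ) * (4 * c * L * B ^ 2) = 4 * L * B ^ 2 := by
    linear_combination (4 * L * B ^ 2) * hcn
  linear_combination hsum + η ^ 2 * hcL

/-! ### Second moments of fresh noise. -/

/-- The noise of an unbiased estimator evaluated at the past adds at most its variance to the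
second moment. -/
theorem integral_sq_add_stochGrad_noise_le {p : ℕ} {S Ω : Type*} [MeasurableSpace S]
    {f : EuclideanSpace ℝ (Fin p) → ℝ} {ℓ : EuclideanSpace ℝ (Fin p) → S → ℝ} {P : Measure S}
    {σ : ℝ} (hℓ : IsStochasticLoss f ℓ P) (hσ : BoundedVariance f ℓ P σ)
    (hf : Continuous (gradient f)) {m mΩ : MeasurableSpace Ω} (hm : m ≤ mΩ) {μ : Measure Ω}
    [IsProbabilityMeasure μ] {A X : Ω → EuclideanSpace ℝ (Fin p)} {ξ : Ω → S}
    (hA : Measurable[m] A) (hX : Measurable[m] X) (hξ : Measurable ξ)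
    (hlaw : Measure.map ξ μ = P)
    (hind : Indep (MeasurableSpace.comap ξ inferInstance) m μ)
    (hAint : Integrable (fun ω => ‖A ω‖ ^ 2) μ) (c : ℝ) :
    Integrable (fun ω => ‖A ω + c • (stochGrad ℓ (X ω) (ξ ω) - gradient f (X ω))‖ ^ 2) μ ∧
    ∫ ω, ‖A ω + c • (stochGrad ℓ (X ω) (ξ ω) - gradient f (X ω))‖ ^ 2 ∂μ
      ≤ ∫ ω, ‖A ω‖ ^ 2 ∂μ + c ^ 2 * σ ^ 2 := by
  have := hℓ.isProbabilityMeasure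
  -- Freezing the past at `(a, x)` kills the cross term by unbiasedness. Tonelli for the product law
  -- of past and sample then replaces conditional expectation, and the lower integral delivers
  -- integrability along with the bound.
  have hinner : ∀ a x : EuclideanSpace ℝ (Fin p),
      ∫⁻ s, ENNReal.ofReal (‖a + c • (stochGrad ℓ x s - gradient f x)‖ ^ 2) ∂P
        ≤ ENNReal.ofReal (‖a‖ ^ 2 + c ^ 2 * σ ^ 2) := by
    intro a x
    have hu : Integrable (fun s => stochGrad ℓ x s - gradient f x) P :=
      (hℓ.integrable_grad x).sub (integrable_const _)
    have hexp : ∀ s, ‖a + c • (stochGrad ℓ x s - gradient f x)‖ ^ 2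
        = ‖a‖ ^ 2 + 2 * c * inner ℝ a (stochGrad ℓ x s - gradient f x)
          + c ^ 2 * ‖stochGrad ℓ x s - gradient f x‖ ^ 2 := by
      intro s
      rw [norm_add_sq_real, inner_smul_right, norm_smul, mul_pow, Real.norm_eq_abs, sq_abs]; ring
    have hi1 : Integrable (fun s => ‖a‖ ^ 2
        + 2 * c * inner ℝ a (stochGrad ℓ x s - gradient f x)) P :=
      (integrable_const _).add ((hu.const_inner a).const_mul _)
    have hi2 := (hσ x).1.const_mul (c ^ 2)
    have hzero : ∫ s, inner ℝ a (stochGrad ℓ x s - gradient f x) ∂P = 0 := by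
      rw [integral_inner hu, integral_sub (hℓ.integrable_grad x) (integrable_const _), hℓ.unbiased]
      simp
    rw [← ofReal_integral_eq_lintegral_ofReal]
    · apply ENNReal.ofReal_le_ofReal
      simp_rw [hexp]
      rw [integral_add hi1 hi2, integral_add (integrable_const _) ((hu.const_inner a).const_mul _),
        integral_const_mul, integral_const_mul, hzero]
      simpa using mul_le_mul_of_nonneg_left (hσ x).2 (sq_nonneg c)
    · simp_rw [hexp]
      exact hi1.add hi2
    · exact Filter.Eventually.of_forall fun s => sq_nonneg _
  have hA' : Measurable A := hA.mono hm le_rfl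
  have hX' : Measurable X := hX.mono hm le_rfl
  have hindep : IndepFun (fun ω => (A ω, X ω)) ξ μ := by
    rw [IndepFun_iff_Indep]
    exact indep_of_indep_of_le_left hind.symm ((hA.prodMk hX).comap_le)
  have hprod := (indepFun_iff_map_prod_eq_prod_map_map (hA'.prodMk hX').aemeasurable
    hξ.aemeasurable).1 hindep
  have hmeas : Measurable (fun q : (EuclideanSpace ℝ (Fin p) × EuclideanSpace ℝ (Fin p)) × S =>
      ‖q.1.1 + c • (stochGrad ℓ q.1.2 q.2 - gradient f q.1.2)‖ ^ 2) := by
    have h1 : Measurable (fun q : (EuclideanSpace ℝ (Fin p) × EuclideanSpace ℝ (Fin p)) × S =>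
        stochGrad ℓ q.1.2 q.2) :=
      hℓ.measurable_grad.comp ((measurable_snd.comp measurable_fst).prodMk measurable_snd)
    have h2 : Measurable (fun q : (EuclideanSpace ℝ (Fin p) × EuclideanSpace ℝ (Fin p)) × S =>
        gradient f q.1.2) := hf.measurable.comp (measurable_snd.comp measurable_fst)
    exact (((measurable_fst.comp measurable_fst).add ((h1.sub h2).const_smul c)).norm).pow_const 2
  have hbound : Integrable (fun ω => ‖A ω‖ ^ 2 + c ^ 2 * σ ^ 2) μ := hAint.add (integrable_const _)
  have hmain : ∫⁻ ω, ENNReal.ofReal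
      (‖A ω + c • (stochGrad ℓ (X ω) (ξ ω) - gradient f (X ω))‖ ^ 2) ∂μ
      ≤ ENNReal.ofReal (∫ ω, ‖A ω‖ ^ 2 ∂μ + c ^ 2 * σ ^ 2) := by
    calc _ = ∫⁻ q, ENNReal.ofReal (‖q.1.1 + c • (stochGrad ℓ q.1.2 q.2 - gradient f q.1.2)‖ ^ 2)
            ∂(Measure.map (fun ω => ((A ω, X ω), ξ ω)) μ) := by
          rw [lintegral_map hmeas.ennreal_ofReal ((hA'.prodMk hX').prodMk hξ)]
      _ = ∫⁻ w, ∫⁻ s, ENNReal.ofReal (‖w.1 + c • (stochGrad ℓ w.2 s - gradient f w.2)‖ ^ 2) ∂P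
            ∂(Measure.map (fun ω => (A ω, X ω)) μ) := by
          rw [hprod, hlaw, lintegral_prod _ hmeas.ennreal_ofReal.aemeasurable]
      _ ≤ ∫⁻ w, ENNReal.ofReal (‖w.1‖ ^ 2 + c ^ 2 * σ ^ 2)
            ∂(Measure.map (fun ω => (A ω, X ω)) μ) := lintegral_mono fun w => hinner w.1 w.2
      _ = ∫⁻ ω, ENNReal.ofReal (‖A ω‖ ^ 2 + c ^ 2 * σ ^ 2) ∂μ := by
          rw [lintegral_map (by fun_prop) (hA'.prodMk hX')]
      _ = ENNReal.ofReal (∫ ω, ‖A ω‖ ^ 2 ∂μ + c ^ 2 * σ ^ 2) := by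
          rw [← ofReal_integral_eq_lintegral_ofReal hbound
            (Filter.Eventually.of_forall fun ω => by positivity),
            integral_add hAint (integrable_const _)]
          simp
  have hnn : 0 ≤ᵐ[μ] fun ω =>
      ‖A ω + c • (stochGrad ℓ (X ω) (ξ ω) - gradient f (X ω))‖ ^ 2 :=
    Filter.Eventually.of_forall fun ω => sq_nonneg _
  have hint : Integrable
      (fun ω => ‖A ω + c • (stochGrad ℓ (X ω) (ξ ω) - gradient f (X ω))‖ ^ 2) μ := by
    refine (lintegral_ofReal_ne_top_iff_integrable ?_ hnn).1
      (hmain.trans_lt ENNReal.ofReal_lt_top).ne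
    exact (hmeas.comp ((hA'.prodMk hX').prodMk hξ)).aestronglyMeasurable
  refine ⟨hint, ?_⟩
  rw [← ofReal_integral_eq_lintegral_ofReal hint hnn] at hmain
  have h0 : 0 ≤ ∫ ω, ‖A ω‖ ^ 2 ∂μ := integral_nonneg fun ω => sq_nonneg _
  exact (ENNReal.ofReal_le_ofReal_iff (by positivity)).1 hmain

/-! ### Elementary inequalities. -/

/-- Since `1 - 1/u ≤ u/(u+1)` and a number in `(0, 1]` is at most its `r`-th power, a contraction by
`1 - 1/u` carries the bound `u ^ (-r)` to the next index. It closes both inductions, with `r = 2/3`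
and `r = 1/3`. -/
theorem Real.one_sub_inv_mul_rpow_neg_le {u r : ℝ} (hu : 0 < u) (hr1 : r ≤ 1) :
    (1 - 1 / u) * u ^ (-r) ≤ (u + 1) ^ (-r) := by
  have hu1 : 0 < u + 1 := by linarith
  have h1 : u / (u + 1) ≤ (u / (u + 1)) ^ r := by
    conv_lhs => rw [← Real.rpow_one (u / (u + 1))]
    exact Real.rpow_le_rpow_of_exponent_ge (by positivity) ((div_le_one hu1).2 (by linarith)) hr1
  have h2 : 1 - 1 / u ≤ u / (u + 1) := by
    rw [one_sub_div hu.ne', div_le_div_iff₀ hu hu1]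
    nlinarith
  have h3 : (u / (u + 1)) ^ r * u ^ (-r) = (u + 1) ^ (-r) := by
    rw [Real.div_rpow hu.le hu1.le, Real.rpow_neg hu.le, Real.rpow_neg hu1.le]
    have := (Real.rpow_pos_of_pos hu r).ne'
    field_simp
  calc (1 - 1 / u) * u ^ (-r) ≤ (u / (u + 1)) ^ r * u ^ (-r) :=
        mul_le_mul_of_nonneg_right (h2.trans h1) (Real.rpow_nonneg hu.le _)
    _ = _ := h3

theorem norm_one_sub_smul_add_smul_le {E : Type*} [SeminormedAddCommGroup E] [NormedSpace ℝ E]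
    {x y : E} {η B : ℝ} (h0 : 0 ≤ η) (h1 : η ≤ 1) (hx : ‖x‖ ≤ B) (hy : ‖y‖ ≤ B) :
    ‖(1 - η) • x + η • y‖ ≤ B := by
  refine (norm_add_le _ _).trans ?_
  rw [norm_smul, norm_smul, Real.norm_of_nonneg h0, Real.norm_of_nonneg (sub_nonneg.2 h1)]
  nlinarith

theorem integrable_continuous_comp_of_norm_le {E Ω : Type*} [NormedAddCommGroup E] [ProperSpace E]
    [MeasurableSpace E] [BorelSpace E] {mΩ : MeasurableSpace Ω} {μ : Measure Ω} [IsFiniteMeasure μ]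
    {φ : E → ℝ} (hφ : Continuous φ) {X : Ω → E} (hX : Measurable X) {B : ℝ}
    (hB : ∀ ω, ‖X ω‖ ≤ B) : Integrable (fun ω => φ (X ω)) μ := by
  obtain ⟨M, hM⟩ := (isCompact_closedBall (0 : E) B).exists_bound_of_continuousOn hφ.continuousOn
  exact Integrable.of_bound (hφ.measurable.comp hX).aestronglyMeasurable M
    (Filter.Eventually.of_forall fun ω => hM _ (by simpa using hB ω))

theorem norm_add_sq_le_young {E : Type*} [NormedAddCommGroup E] [InnerProductSpace ℝ E]
    (u w : E) {r : ℝ} (hr : 0 < r) :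
    ‖u + w‖ ^ 2 ≤ (1 + r) * ‖u‖ ^ 2 + (1 + 1 / r) * ‖w‖ ^ 2 := by
  have h1 : ‖u + w‖ ^ 2 ≤ (‖u‖ + ‖w‖) ^ 2 :=
    pow_le_pow_left₀ (norm_nonneg _) (norm_add_le u w) 2
  have h2 : 2 * ‖u‖ * ‖w‖ ≤ r * ‖u‖ ^ 2 + 1 / r * ‖w‖ ^ 2 := by
    have : r * ‖u‖ ^ 2 + 1 / r * ‖w‖ ^ 2 - 2 * ‖u‖ * ‖w‖ = (r * ‖u‖ - ‖w‖) ^ 2 / r := by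
      field_simp; ring
    have h3 : 0 ≤ (r * ‖u‖ - ‖w‖) ^ 2 / r := by positivity
    linarith
  nlinarith

/-! ### Runs with general parameters: bounds, adaptedness, gradient error. -/

namespace IsFedFWStoRun

variable {p n : ℕ} {S : Fin n → Type*} [∀ i, MeasurableSpace (S i)]
  {Ω : Type*} {mΩ : MeasurableSpace Ω} {D : Set (EuclideanSpace ℝ (Fin p))}
  {ℓ : (i : Fin n) → EuclideanSpace ℝ (Fin p) → S i → ℝ} {P : (i : Fin n) → Measure (S i)}
  {η lam ρ : ℕ → ℝ} {x₁ : Fin n → EuclideanSpace ℝ (Fin p)} {μ : Measure Ω} {ℱ : Filtration ℕ mΩ}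
  {ξ : ℕ → (i : Fin n) → Ω → S i} {x d g s : ℕ → Fin n → Ω → EuclideanSpace ℝ (Fin p)}
  {xbar : ℕ → Ω → EuclideanSpace ℝ (Fin p)} {f : Fin n → EuclideanSpace ℝ (Fin p) → ℝ}
  {σ B : ℝ} {L : NNReal}

theorem norm_x_le (h : IsFedFWStoRun D ℓ P η lam ρ x₁ μ ℱ ξ x d g s xbar)
    (hη0 : ∀ t ≥ 1, 0 ≤ η t) (hη1 : ∀ t ≥ 1, η t ≤ 1) (hD : ∀ y ∈ D, ‖y‖ ≤ B)
    (hx₁ : ∀ i, ‖x₁ i‖ ≤ B) {t : ℕ} (ht : 1 ≤ t) (i : Fin n) (ω : Ω) : ‖x t i ω‖ ≤ B := by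
  induction t, ht using Nat.le_induction with
  | base => rw [h.x_init]; exact hx₁ i
  | succ t ht ih =>
    rw [h.x_step t ht]
    exact norm_one_sub_smul_add_smul_le (hη0 t ht) (hη1 t ht) ih (hD _ (h.s_mem t ht i ω))

theorem xbar_eq (h : IsFedFWStoRun D ℓ P η lam ρ x₁ μ ℱ ξ x d g s xbar) {t : ℕ} (ht : 1 ≤ t)
    (ω : Ω) : xbar t ω = (1 / (n : ℝ)) • ∑ i, x t i ω := by
  induction t, ht using Nat.le_induction with
  | base => simp_rw [h.xbar_init, h.x_init]
  | succ t ht ih =>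
    simp_rw [h.xbar_step t ht, h.x_step t ht, ih, Finset.sum_add_distrib, ← Finset.smul_sum]
    module

theorem measurable_x (h : IsFedFWStoRun D ℓ P η lam ρ x₁ μ ℱ ξ x d g s xbar) {t : ℕ}
    (ht : 1 ≤ t) (i : Fin n) : Measurable[ℱ t] (x t i) := by
  induction t, ht using Nat.le_induction with
  | base =>
    rw [show x 1 i = fun _ => x₁ i from funext fun ω => h.x_init i ω]
    exact measurable_const
  | succ t ht ih =>
    rw [show x (t + 1) i = fun ω => (1 - η t) • x t i ω + η t • s t i ω from
      funext fun ω => h.x_step t ht i ω]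
    exact ((ih.mono (ℱ.mono t.le_succ) le_rfl).const_smul (1 - η t)).add
      ((h.s_measurable t ht i).const_smul (η t))

theorem measurable_d (h : IsFedFWStoRun D ℓ P η lam ρ x₁ μ ℱ ξ x d g s xbar) {t : ℕ}
    (ht : 1 ≤ t) (i : Fin n) (hℓ : IsStochasticLoss (f i) (ℓ i) (P i)) :
    Measurable[ℱ t] (d t i) := by
  induction t, ht using Nat.le_induction with
  | base =>
    rw [show d 1 i = fun _ => 0 from funext fun ω => h.d_init i ω]
    exact measurable_const
  | succ t ht ih =>
    rw [show d (t + 1) i = fun ω => (1 - ρ t) • d t i ω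
        + ρ t • ((1 / (n : ℝ)) • stochGrad (ℓ i) (x t i ω) (ξ t i ω)) from
      funext fun ω => h.d_step t ht i ω]
    have hg : Measurable[ℱ (t + 1)] fun ω => stochGrad (ℓ i) (x t i ω) (ξ t i ω) :=
      hℓ.measurable_grad.comp
        (((h.measurable_x ht i).mono (ℱ.mono t.le_succ) le_rfl).prodMk (h.sample_measurable t ht i))
    exact ((ih.mono (ℱ.mono t.le_succ) le_rfl).const_smul (1 - ρ t)).add
      ((hg.const_smul (1 / (n : ℝ))).const_smul (ρ t))

/-- The new error is `1 - ρ t` times the old one at the same point, which is known at time `t`, plus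
`ρ t / n` times centred fresh noise. -/
theorem integral_gradError_sq_step [IsProbabilityMeasure μ]
    (h : IsFedFWStoRun D ℓ P η lam ρ x₁ μ ℱ ξ x d g s xbar) {t : ℕ} (ht : 1 ≤ t) (i : Fin n)
    (hℓ : IsStochasticLoss (f i) (ℓ i) (P i)) (hσ : BoundedVariance (f i) (ℓ i) (P i) σ)
    (hf : Continuous (gradient (f i)))
    (hint : Integrable (fun ω => ‖d t i ω - (1 / (n : ℝ)) • gradient (f i) (x t i ω)‖ ^ 2) μ) :
    Integrable (fun ω => ‖d (t + 1) i ω - (1 / (n : ℝ)) • gradient (f i) (x t i ω)‖ ^ 2) μ ∧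
    ∫ ω, ‖d (t + 1) i ω - (1 / (n : ℝ)) • gradient (f i) (x t i ω)‖ ^ 2 ∂μ
      ≤ (1 - ρ t) ^ 2 * ∫ ω, ‖d t i ω - (1 / (n : ℝ)) • gradient (f i) (x t i ω)‖ ^ 2 ∂μ
        + ρ t ^ 2 * σ ^ 2 := by
  set c := 1 / (n : ℝ)
  have hc : c ^ 2 ≤ 1 := by
    have hn : (1 : ℝ) ≤ n := by exact_mod_cast i.pos
    refine pow_le_one₀ (by positivity) ?_
    exact (div_le_one (by linarith)).2 hn
  have hmx := h.measurable_x ht i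
  have hmA : Measurable[ℱ t] fun ω => (1 - ρ t) • (d t i ω - c • gradient (f i) (x t i ω)) :=
    ((h.measurable_d ht i hℓ).sub ((hf.measurable.comp hmx).const_smul c)).const_smul (1 - ρ t)
  have hnorm : ∀ ω, ‖(1 - ρ t) • (d t i ω - c • gradient (f i) (x t i ω))‖ ^ 2
      = (1 - ρ t) ^ 2 * ‖d t i ω - c • gradient (f i) (x t i ω)‖ ^ 2 := fun ω => by
    rw [norm_smul, mul_pow, Real.norm_eq_abs, sq_abs]
  have hξ : Measurable (ξ t i) := (h.sample_measurable t ht i).mono (ℱ.le _) le_rfl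
  have key := integral_sq_add_stochGrad_noise_le hℓ hσ hf (ℱ.le t) hmA hmx hξ
    (h.sample_law t ht i) (h.sample_indep t ht i)
    (by simp_rw [hnorm]; exact hint.const_mul _) (ρ t * c)
  have heq : ∀ ω, (1 - ρ t) • (d t i ω - c • gradient (f i) (x t i ω))
      + (ρ t * c) • (stochGrad (ℓ i) (x t i ω) (ξ t i ω) - gradient (f i) (x t i ω))
      = d (t + 1) i ω - c • gradient (f i) (x t i ω) := fun ω => by
    rw [h.d_step t ht]; module
  simp_rw [heq, hnorm, integral_const_mul] at key
  refine ⟨key.1, key.2.trans ?_⟩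
  have : (ρ t * c) ^ 2 * σ ^ 2 ≤ ρ t ^ 2 * σ ^ 2 := by
    rw [mul_pow]
    nlinarith [mul_nonneg (sq_nonneg (ρ t)) (sq_nonneg σ)]
  linarith

theorem norm_gradient_drift_le (h : IsFedFWStoRun D ℓ P η lam ρ x₁ μ ℱ ξ x d g s xbar)
    (hη0 : ∀ t ≥ 1, 0 ≤ η t) (hη1 : ∀ t ≥ 1, η t ≤ 1) (hD : ∀ y ∈ D, ‖y‖ ≤ B)
    (hx₁ : ∀ i, ‖x₁ i‖ ≤ B) {t : ℕ} (ht : 1 ≤ t) (i : Fin n)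
    (hL : LipschitzWith L (gradient (f i))) (ω : Ω) :
    ‖(1 / (n : ℝ)) • gradient (f i) (x t i ω) - (1 / (n : ℝ)) • gradient (f i) (x (t + 1) i ω)‖
      ≤ 2 * L * B * η t := by
  have hn : (1 : ℝ) ≤ n := by exact_mod_cast i.pos
  have hc : 1 / (n : ℝ) ≤ 1 := (div_le_one (by linarith)).2 hn
  have h1 := hL.dist_le_mul (x t i ω) (x (t + 1) i ω)
  rw [dist_eq_norm, dist_eq_norm] at h1
  have e : x t i ω - x (t + 1) i ω = η t • (x t i ω - s t i ω) := by
    rw [h.x_step t ht]; module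
  have h2 : ‖x t i ω - s t i ω‖ ≤ 2 * B := (norm_sub_le _ _).trans
    (by linarith [h.norm_x_le hη0 hη1 hD hx₁ ht i ω, hD _ (h.s_mem t ht i ω)])
  rw [e, norm_smul, Real.norm_of_nonneg (hη0 t ht)] at h1
  rw [← smul_sub, norm_smul, Real.norm_of_nonneg (by positivity)]
  calc 1 / (n : ℝ) * ‖gradient (f i) (x t i ω) - gradient (f i) (x (t + 1) i ω)‖
      ≤ 1 * ‖gradient (f i) (x t i ω) - gradient (f i) (x (t + 1) i ω)‖ :=
        mul_le_mul_of_nonneg_right hc (norm_nonneg _)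
    _ ≤ L * (η t * (2 * B)) := by
        rw [one_mul]
        exact h1.trans (mul_le_mul_of_nonneg_left
          (mul_le_mul_of_nonneg_left h2 (hη0 t ht)) L.coe_nonneg)
    _ = 2 * L * B * η t := by ring

/-- Recursion for the second moment of the gradient estimation error. -/
theorem integral_gradError_sq_succ [IsProbabilityMeasure μ]
    (h : IsFedFWStoRun D ℓ P η lam ρ x₁ μ ℱ ξ x d g s xbar)
    (hη0 : ∀ t ≥ 1, 0 ≤ η t) (hη1 : ∀ t ≥ 1, η t ≤ 1) (hD : ∀ y ∈ D, ‖y‖ ≤ B)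
    (hx₁ : ∀ i, ‖x₁ i‖ ≤ B) {t : ℕ} (ht : 1 ≤ t) (hρ0 : 0 < ρ (t + 1)) (hρ1 : ρ (t + 1) ≤ 1)
    (i : Fin n) (hℓ : IsStochasticLoss (f i) (ℓ i) (P i))
    (hσ : BoundedVariance (f i) (ℓ i) (P i) σ) (hL : LipschitzWith L (gradient (f i)))
    (hint : Integrable
      (fun ω => ‖d (t + 1) i ω - (1 / (n : ℝ)) • gradient (f i) (x t i ω)‖ ^ 2) μ) :
    Integrable
      (fun ω => ‖d (t + 1 + 1) i ω - (1 / (n : ℝ)) • gradient (f i) (x (t + 1) i ω)‖ ^ 2) μ ∧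
    ∫ ω, ‖d (t + 1 + 1) i ω - (1 / (n : ℝ)) • gradient (f i) (x (t + 1) i ω)‖ ^ 2 ∂μ
      ≤ (1 - ρ (t + 1)) * ∫ ω, ‖d (t + 1) i ω - (1 / (n : ℝ)) • gradient (f i) (x t i ω)‖ ^ 2 ∂μ
        + (2 * L * B * η t) ^ 2 / ρ (t + 1) + ρ (t + 1) ^ 2 * σ ^ 2 := by
  set c := 1 / (n : ℝ)
  set r := ρ (t + 1)
  -- Young's inequality with parameter `ρ (t + 1)`: of the two factors `1 - r` from the averaging
  -- step, one absorbs the inflation `1 + r` and the other remains as contraction.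
  have hyoung : ∀ ω, ‖d (t + 1) i ω - c • gradient (f i) (x (t + 1) i ω)‖ ^ 2
      ≤ (1 + r) * ‖d (t + 1) i ω - c • gradient (f i) (x t i ω)‖ ^ 2
        + (1 + 1 / r) * (2 * L * B * η t) ^ 2 := by
    intro ω
    have hw := h.norm_gradient_drift_le hη0 hη1 hD hx₁ ht i hL ω
    have := norm_add_sq_le_young (d (t + 1) i ω - c • gradient (f i) (x t i ω))
      (c • gradient (f i) (x t i ω) - c • gradient (f i) (x (t + 1) i ω)) hρ0
    rw [sub_add_sub_cancel] at this
    refine this.trans ?_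
    gcongr
  have hdom := (hint.const_mul (1 + r)).add (integrable_const ((1 + 1 / r) * (2 * L * B * η t) ^ 2))
  have ht1 : 1 ≤ t + 1 := by omega
  have hmeas : Measurable fun ω => ‖d (t + 1) i ω - c • gradient (f i) (x (t + 1) i ω)‖ ^ 2 := by
    have h1 := (h.measurable_d ht1 i hℓ).mono (ℱ.le _) le_rfl
    have h2 := (h.measurable_x ht1 i).mono (ℱ.le _) le_rfl
    exact ((h1.sub ((hL.continuous.measurable.comp h2).const_smul c)).norm).pow_const 2
  have hint' : Integrable
      (fun ω => ‖d (t + 1) i ω - c • gradient (f i) (x (t + 1) i ω)‖ ^ 2) μ :=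
    hdom.mono' hmeas.aestronglyMeasurable (Filter.Eventually.of_forall fun ω => by
      rw [Real.norm_of_nonneg (sq_nonneg _)]
      exact hyoung ω)
  have hstep := h.integral_gradError_sq_step ht1 i hℓ hσ hL.continuous hint'
  refine ⟨hstep.1, hstep.2.trans ?_⟩
  have hle := integral_mono hint' hdom hyoung
  simp only [Pi.add_apply] at hle
  rw [integral_add (hint.const_mul _) (integrable_const _), integral_const_mul] at hle
  simp only [integral_const, probReal_univ, smul_eq_mul, one_mul] at hle
  set V := ∫ ω, ‖d (t + 1) i ω - c • gradient (f i) (x t i ω)‖ ^ 2 ∂μ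
  have hV : 0 ≤ V := integral_nonneg fun ω => sq_nonneg _
  set W := (2 * L * B * η t) ^ 2
  have hW : 0 ≤ W := sq_nonneg _
  have h1 := mul_le_mul_of_nonneg_left hle (sq_nonneg (1 - r))
  have hr1 : (1 - r) ^ 2 * (1 + r) ≤ 1 - r := by nlinarith [mul_nonneg (sub_nonneg.2 hρ1) (sq_nonneg r)]
  have hr2 : (1 - r) ^ 2 * (1 + 1 / r) ≤ 1 / r := by
    rw [show (1 - r) ^ 2 * (1 + 1 / r) = ((1 - r) ^ 2 * (1 + r)) / r by field_simp; ring]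
    exact div_le_div_of_nonneg_right (by linarith) hρ0.le
  have h2 := mul_le_mul_of_nonneg_right hr1 hV
  have h3 := mul_le_mul_of_nonneg_right hr2 hW
  have h4 : 1 / r * W = W / r := by ring
  nlinarith

end IsFedFWStoRun

/-! ### The scalar recursion and the growth of the penalty. -/

/-- A Chung-type recursion with step `9 / (t + 8)` and noise of order `(t + 8) ^ (-4 / 3)`. -/
theorem le_mul_rpow_of_recursion {a : ℕ → ℝ} {c K : ℝ} (hK : 0 ≤ K) (hcK : c ≤ 8 * K)
    (h1 : a 1 ≤ K * 9 ^ (-(1 / 3 : ℝ)))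
    (hrec : ∀ t : ℕ, 1 ≤ t → a (t + 1) ≤ (1 - 9 / ((t : ℝ) + 8)) * a t
      + c * (((t : ℝ) + 8) ^ (-(1 / 3 : ℝ)) / ((t : ℝ) + 8))) {t : ℕ} (ht : 1 ≤ t) :
    a t ≤ K * ((t : ℝ) + 8) ^ (-(1 / 3 : ℝ)) := by
  induction t, ht using Nat.le_induction with
  | base => norm_num at h1 ⊢; exact h1
  | succ t ht ih =>
    have ht' : (1 : ℝ) ≤ t := by exact_mod_cast ht
    set u : ℝ := (t : ℝ) + 8 with hu
    have hu9 : 9 ≤ u := by linarith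
    have hu0 : 0 < u := by linarith
    have hz : 0 ≤ u ^ (-(1 / 3 : ℝ)) := Real.rpow_nonneg hu0.le _
    have h9 : 0 ≤ 1 - 9 / u := sub_nonneg.2 ((div_le_one hu0).2 hu9)
    have hrate := mul_le_mul_of_nonneg_left
      (Real.one_sub_inv_mul_rpow_neg_le hu0 (by norm_num : (1 / 3 : ℝ) ≤ 1)) hK
    have e : ((t + 1 : ℕ) : ℝ) + 8 = u + 1 := by push_cast; ring
    rw [e]
    have h2 := mul_le_mul_of_nonneg_left ih h9
    have h3 : c * (u ^ (-(1 / 3 : ℝ)) / u) ≤ 8 * K * (u ^ (-(1 / 3 : ℝ)) / u) :=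
      mul_le_mul_of_nonneg_right hcK (by positivity)
    -- Of the contraction `9 / u`, the share `8 / u` absorbs the noise and `1 / u` drives the decay.
    have h4 : (1 - 9 / u) * (K * u ^ (-(1 / 3 : ℝ))) + 8 * K * (u ^ (-(1 / 3 : ℝ)) / u)
        = K * ((1 - 1 / u) * u ^ (-(1 / 3 : ℝ))) := by ring
    linarith [hrec t ht]

/-- With `η = 9 / u`, the factor `1 - 2 * η` is at most `(1 - η) * (1 - 1 / u)`, and `1 - 1 / u`
compensates the increase of the penalty weight from `√(u - 1)` to `√u`. -/
theorem sqrt_mul_one_sub_le {u : ℝ} (hu : 9 ≤ u) :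
    √u * (1 - 2 * (9 / u)) ≤ (1 - 9 / u) * √(u - 1) := by
  have hu0 : 0 < u := by linarith
  have h1 : √u * (1 - 1 / u) ≤ √(u - 1) := by
    have hnn : 0 ≤ 1 - 1 / u := sub_nonneg.2 ((div_le_one hu0).2 (by linarith))
    apply Real.le_sqrt_of_sq_le
    rw [mul_pow, Real.sq_sqrt hu0.le]
    have : u * (1 - 1 / u) ^ 2 = (u - 1) * (1 - 1 / u) := by field_simp
    rw [this]
    nlinarith [one_div_pos.2 hu0]
  have h9 : 0 ≤ 1 - 9 / u := sub_nonneg.2 ((div_le_one hu0).2 hu)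
  have h2 := mul_le_mul_of_nonneg_left h1 h9
  have h3 : 1 - 2 * (9 / u) ≤ (1 - 9 / u) * (1 - 1 / u) := by
    have : (1 - 9 / u) * (1 - 1 / u) - (1 - 2 * (9 / u)) = 8 / u + 9 / u ^ 2 := by field_simp; ring
    have h4 : 0 ≤ 8 / u + 9 / u ^ 2 := by positivity
    linarith
  nlinarith [mul_le_mul_of_nonneg_left h3 (Real.sqrt_nonneg u)]

/-! ### The potential and its relation to the global loss. -/

/-- The optimality gap of the local models plus the consensus penalty. -/
noncomputable def penalizedGap {p n : ℕ} (f : Fin n → EuclideanSpace ℝ (Fin p) → ℝ)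
    (z : EuclideanSpace ℝ (Fin p)) (lam : ℝ) (x : Fin n → EuclideanSpace ℝ (Fin p))
    (xbar : EuclideanSpace ℝ (Fin p)) : ℝ :=
  (1 / (n : ℝ)) * ∑ i, f i (x i) - (1 / (n : ℝ)) * ∑ i, f i z + lam / 2 * ∑ i, ‖x i - xbar‖ ^ 2

/-- The tangent inequality at `xbar` bounds `f i xbar - f i (x i)` by `G * ‖x i - xbar‖`; completing
the square against the penalty leaves `G ^ 2 / (2 * lam)`. -/
theorem globalLoss_sub_le_penalizedGap {p n : ℕ} (hn : 0 < n)
    {f : Fin n → EuclideanSpace ℝ (Fin p) → ℝ} (hf : ∀ i, ConvexOn ℝ Set.univ (f i))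
    (hd : ∀ i, Differentiable ℝ (f i)) {z xbar : EuclideanSpace ℝ (Fin p)}
    {x : Fin n → EuclideanSpace ℝ (Fin p)} {lam G : ℝ} (hlam : 0 < lam)
    (hG : ∀ i, ‖gradient (f i) xbar‖ ≤ G) :
    globalLoss f xbar - globalLoss f z ≤ penalizedGap f z lam x xbar + G ^ 2 / (2 * lam) := by
  have hn1 : (1 : ℝ) ≤ n := by exact_mod_cast hn
  set c := 1 / (n : ℝ) with hc
  have hc0 : 0 < c := by positivity
  have hc1 : c ≤ 1 := (div_le_one (by linarith)).2 hn1
  have hterm : ∀ i, c * f i xbar ≤ c * f i (x i) + lam / 2 * ‖x i - xbar‖ ^ 2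
      + c * (G ^ 2 / (2 * lam)) := by
    intro i
    have h1 := (hf i).add_inner_gradient_le (hd i xbar) (x i)
    have h2 : - (G * ‖x i - xbar‖) ≤ inner ℝ (gradient (f i) xbar) (x i - xbar) := by
      have := neg_le_of_abs_le (abs_real_inner_le_norm (gradient (f i) xbar) (x i - xbar))
      have := mul_le_mul_of_nonneg_right (hG i) (norm_nonneg (x i - xbar))
      linarith
    have h3 : G * ‖x i - xbar‖ ≤ lam / 2 * ‖x i - xbar‖ ^ 2 + G ^ 2 / (2 * lam) := by
      have : lam / 2 * ‖x i - xbar‖ ^ 2 + G ^ 2 / (2 * lam) - G * ‖x i - xbar‖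
          = (lam * ‖x i - xbar‖ - G) ^ 2 / (2 * lam) := by field_simp; ring
      have : 0 ≤ (lam * ‖x i - xbar‖ - G) ^ 2 / (2 * lam) := by positivity
      linarith
    have h4 : 0 ≤ lam / 2 * ‖x i - xbar‖ ^ 2 := by positivity
    nlinarith
  have hsum := Finset.sum_le_sum fun i (_ : i ∈ Finset.univ) => hterm i
  simp only [Finset.sum_add_distrib, ← Finset.mul_sum, Finset.sum_const, Finset.card_univ,
    Fintype.card_fin, nsmul_eq_mul] at hsum
  have hcn : (n : ℝ) * c = 1 := by rw [hc]; field_simp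
  rw [← mul_assoc c, mul_comm c (n : ℝ), hcn, one_mul] at hsum
  simp only [globalLoss, penalizedGap]
  linarith

/-! ### Rates for the prescribed parameters. -/

namespace IsFedFWStoRun

variable {p n : ℕ} {S : Fin n → Type*} [∀ i, MeasurableSpace (S i)]
  {Ω : Type*} {mΩ : MeasurableSpace Ω} {D : Set (EuclideanSpace ℝ (Fin p))}
  {ℓ : (i : Fin n) → EuclideanSpace ℝ (Fin p) → S i → ℝ} {P : (i : Fin n) → Measure (S i)}
  {lam ρ : ℕ → ℝ} {x₁ : Fin n → EuclideanSpace ℝ (Fin p)} {μ : Measure Ω} {ℱ : Filtration ℕ mΩ}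
  {ξ : ℕ → (i : Fin n) → Ω → S i} {x d g s : ℕ → Fin n → Ω → EuclideanSpace ℝ (Fin p)}
  {xbar : ℕ → Ω → EuclideanSpace ℝ (Fin p)} {f : Fin n → EuclideanSpace ℝ (Fin p) → ℝ}
  {σ B lam0 Q : ℝ} {L : NNReal} {z : EuclideanSpace ℝ (Fin p)}

theorem stepSize_nonneg : ∀ t ≥ 1, 0 ≤ (fun t : ℕ => 9 / ((t : ℝ) + 8)) t :=
  fun t _ => by positivity

theorem stepSize_le_one : ∀ t ≥ 1, (fun t : ℕ => 9 / ((t : ℝ) + 8)) t ≤ 1 := fun t ht => by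
  have : (1 : ℝ) ≤ t := by exact_mod_cast ht
  exact (div_le_one (by positivity)).2 (by linarith)

/-- The gradient estimation error decays at rate `t ^ (-2 / 3)` in mean square. -/
theorem integral_gradError_sq_le [IsProbabilityMeasure μ]
    (h : IsFedFWStoRun D ℓ P (fun t => 9 / ((t : ℝ) + 8)) lam
      (fun t => 4 / ((t : ℝ) + 7) ^ ((2 : ℝ) / 3)) x₁ μ ℱ ξ x d g s xbar)
    (hD : ∀ y ∈ D, ‖y‖ ≤ B) (hx₁ : ∀ i, ‖x₁ i‖ ≤ B)
    (i : Fin n) (hℓ : IsStochasticLoss (f i) (ℓ i) (P i))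
    (hσ : BoundedVariance (f i) (ℓ i) (P i) σ) (hL : LipschitzWith L (gradient (f i)))
    (hQ : Q = 9 * σ ^ 2 + 27 * L ^ 2 * B ^ 2) {t : ℕ} (ht : 1 ≤ t) :
    Integrable (fun ω => ‖d (t + 1) i ω - (1 / (n : ℝ)) • gradient (f i) (x t i ω)‖ ^ 2) μ ∧
    ∫ ω, ‖d (t + 1) i ω - (1 / (n : ℝ)) • gradient (f i) (x t i ω)‖ ^ 2 ∂μ
      ≤ Q * ((t : ℝ) + 8) ^ (-(2 / 3 : ℝ)) := by
  have hQ0 : 0 ≤ Q := hQ ▸ by positivity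
  induction t, ht using Nat.le_induction with
  | base =>
    have hint : Integrable
        (fun ω => ‖d 1 i ω - (1 / (n : ℝ)) • gradient (f i) (x 1 i ω)‖ ^ 2) μ := by
      simp_rw [h.d_init, h.x_init]
      exact integrable_const _
    have hstep := h.integral_gradError_sq_step le_rfl i hℓ hσ hL.continuous hint
    refine ⟨hstep.1, hstep.2.trans ?_⟩
    have h8 : (8 : ℝ) ^ ((2 : ℝ) / 3) = 4 := by
      rw [show (8 : ℝ) = 2 ^ (3 : ℝ) by norm_num, ← Real.rpow_mul (by norm_num)]
      norm_num
    -- The first weight is exactly 1, so the initial `d = 0` is forgotten and only noise remains;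
    -- the 9 in `Q` covers it, as `9 ^ (-2/3) ≥ 1/9`.
    have hρ : (4 : ℝ) / (((1 : ℕ) : ℝ) + 7) ^ ((2 : ℝ) / 3) = 1 := by
      rw [show ((1 : ℕ) : ℝ) + 7 = 8 by norm_num, h8]; norm_num
    have h9 : (1 / 9 : ℝ) ≤ (((1 : ℕ) : ℝ) + 8) ^ (-(2 / 3 : ℝ)) := by
      rw [show ((1 : ℕ) : ℝ) + 8 = 9 by norm_num, show (1 / 9 : ℝ) = 9 ^ (-1 : ℝ) by
        rw [Real.rpow_neg_one]; norm_num]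
      exact Real.rpow_le_rpow_of_exponent_le (by norm_num) (by norm_num)
    have h1 := mul_le_mul_of_nonneg_left h9 hQ0
    rw [hρ, sub_self]
    have h2 : 0 ≤ (L : ℝ) ^ 2 * B ^ 2 := by positivity
    linarith
  | succ t ht ih =>
    have ht' : (1 : ℝ) ≤ t := by exact_mod_cast ht
    set u : ℝ := (t : ℝ) + 8 with hu
    have hu9 : 9 ≤ u := by linarith
    have hu0 : 0 < u := by linarith
    have e7 : ((t + 1 : ℕ) : ℝ) + 7 = u := by push_cast; ring
    have e8 : ((t + 1 : ℕ) : ℝ) + 8 = u + 1 := by push_cast; ring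
    set y : ℝ := u ^ (-(2 / 3 : ℝ)) with hy
    have hy0 : 0 < y := Real.rpow_pos_of_pos hu0 _
    have hρ : (4 : ℝ) / (((t + 1 : ℕ) : ℝ) + 7) ^ ((2 : ℝ) / 3) = 4 * y := by
      rw [e7, hy, Real.rpow_neg hu0.le, div_eq_mul_inv]
    have hy4 : 4 * y ≤ 1 := by
      have h8 : (8 : ℝ) ^ (-(2 / 3 : ℝ)) = 1 / 4 := by
        rw [show (8 : ℝ) = 2 ^ (3 : ℝ) by norm_num, ← Real.rpow_mul (by norm_num)]
        norm_num
      have : y ≤ (8 : ℝ) ^ (-(2 / 3 : ℝ)) :=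
        Real.rpow_le_rpow_of_nonpos (by norm_num) (by linarith) (by norm_num)
      linarith
    have hyu : 1 / u ≤ y := by
      rw [one_div, ← Real.rpow_neg_one]
      exact Real.rpow_le_rpow_of_exponent_le (by linarith) (by norm_num)
    have hy3 : (1 / u) ^ 2 = y ^ 3 := by
      rw [hy, ← Real.rpow_natCast, ← Real.rpow_natCast, ← Real.rpow_mul hu0.le, one_div,
        ← Real.rpow_neg_one, ← Real.rpow_mul hu0.le]
      norm_num
    have hstep := h.integral_gradError_sq_succ stepSize_nonneg stepSize_le_one hD hx₁ ht
      (by rw [hρ]; positivity) (by rw [hρ]; exact hy4) i hℓ hσ hL ih.1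
    refine ⟨hstep.1, hstep.2.trans ?_⟩
    rw [hρ, e8]
    have h1 := mul_le_mul_of_nonneg_left ih.2 (sub_nonneg.2 hy4)
    have h2 : (2 * (L : ℝ) * B * (9 / u)) ^ 2 / (4 * y) = 81 * L ^ 2 * B ^ 2 * y ^ 2 := by
      rw [show (2 * (L : ℝ) * B * (9 / u)) ^ 2 = 324 * L ^ 2 * B ^ 2 * (1 / u) ^ 2 by ring, hy3]
      field_simp; ring
    have h3 := mul_le_mul_of_nonneg_left
      (Real.one_sub_inv_mul_rpow_neg_le hu0 (by norm_num : (2 / 3 : ℝ) ≤ 1)) hQ0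
    rw [← hy] at h3
    have h4 : Q * ((1 - y) * y) ≤ Q * ((1 - 1 / u) * y) :=
      mul_le_mul_of_nonneg_left (mul_le_mul_of_nonneg_right (by linarith) hy0.le) hQ0
    rw [h2]
    have h5 : 0 ≤ σ ^ 2 * y ^ 2 := by positivity
    -- Here `ρ = 4 * y`. A part `3 * y` of the contraction absorbs drift and noise, since `3 * Q =
    -- 27 * σ ^ 2 + 81 * L ^ 2 * B ^ 2`; the remaining `y ≥ 1 / u` is enough for the decay.
    have h6 : (1 - 4 * y) * (Q * y) + 81 * L ^ 2 * B ^ 2 * y ^ 2 + (4 * y) ^ 2 * σ ^ 2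
        ≤ Q * ((1 - y) * y) := by
      have : Q * ((1 - y) * y)
          - ((1 - 4 * y) * (Q * y) + 81 * L ^ 2 * B ^ 2 * y ^ 2 + (4 * y) ^ 2 * σ ^ 2)
          = 11 * (σ ^ 2 * y ^ 2) := by rw [hQ]; ring
      linarith
    linarith

/-- A pathwise bound. The potential at time `t` carries the weight of the previous round, `lam0 *
√(t + 7)`. The error norm `r` is split as `2 * r ≤ y + r ^ 2 / y` with `y = u ^ (-1/3)`, the balance
at which a mean square of order `y ^ 2` makes both terms of order `y`. -/
theorem penalizedGap_succ_le (hn : 0 < n)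
    (h : IsFedFWStoRun D ℓ P (fun t => 9 / ((t : ℝ) + 8)) (fun t => lam0 * √((t : ℝ) + 8)) ρ
      x₁ μ ℱ ξ x d g s xbar)
    (hlam0 : 0 < lam0) (hD : ∀ y ∈ D, ‖y‖ ≤ B) (hx₁ : ∀ i, ‖x₁ i‖ ≤ B) (hz : z ∈ D)
    (hf : ∀ i, ConvexOn ℝ Set.univ (f i)) (hs : ∀ i, LSmooth L (f i)) {t : ℕ} (ht : 1 ≤ t)
    (ω : Ω) :
    penalizedGap f z (lam0 * √((t : ℝ) + 8)) (fun i => x (t + 1) i ω) (xbar (t + 1) ω)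
      ≤ (1 - 9 / ((t : ℝ) + 8)) *
          penalizedGap f z (lam0 * √((t : ℝ) + 7)) (fun i => x t i ω) (xbar t ω)
        + 9 / ((t : ℝ) + 8) * ∑ i, B * (((t : ℝ) + 8) ^ (-(1 / 3 : ℝ))
          + ((t : ℝ) + 8) ^ (1 / 3 : ℝ)
            * ‖d (t + 1) i ω - (1 / (n : ℝ)) • gradient (f i) (x t i ω)‖ ^ 2)
        + 81 * (4 * L * B ^ 2 + 8 * n * lam0 * B ^ 2)
          * (((t : ℝ) + 8) ^ (-(1 / 3 : ℝ)) / ((t : ℝ) + 8)) := by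
  have ht' : (1 : ℝ) ≤ t := by exact_mod_cast ht
  have e7 : (t : ℝ) + 7 = (t : ℝ) + 8 - 1 := by ring
  rw [e7]
  set u : ℝ := (t : ℝ) + 8 with hu
  have hu9 : 9 ≤ u := by linarith
  have hu0 : 0 < u := by linarith
  have hB : 0 ≤ B := (norm_nonneg z).trans (hD z hz)
  have hstep := penalized_frankWolfe_step hf (fun i => (hs i).differentiable)
    (fun i => (hs i).lipschitz) (c := 1 / (n : ℝ)) (η := 9 / u) (lam := lam0 * √u) (B := B)
    (x := fun i => x t i ω) (s := fun i => s t i ω) (d := fun i => d (t + 1) i ω)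
    (xbar := xbar t ω) (z := z) (by positivity)
    (by rw [Fintype.card_fin]; have : (n : ℝ) ≠ 0 := by exact_mod_cast hn.ne'
        field_simp) (by positivity) (by positivity) (h.xbar_eq ht ω)
    (fun i => h.norm_x_le stepSize_nonneg stepSize_le_one hD hx₁ ht i ω)
    (fun i => hD _ (h.s_mem t ht i ω)) (hD z hz)
    (fun i => by
      have := h.s_isMinOn t ht i ω hz
      simpa only [h.g_def t ht, Set.mem_ofPred_eq] using this)
  rw [Fintype.card_fin] at hstep
  simp only [penalizedGap, h.x_step t ht, h.xbar_step t ht]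
  refine hstep.trans ?_
  set δ := ∑ i, ‖x t i ω - xbar t ω‖ ^ 2
  have hδ : 0 ≤ δ := Finset.sum_nonneg fun i _ => sq_nonneg _
  have hpen : lam0 * √u / 2 * (1 - 2 * (9 / u)) * δ ≤ (1 - 9 / u) * (lam0 * √(u - 1) / 2 * δ) := by
    have := mul_le_mul_of_nonneg_left (sqrt_mul_one_sub_le hu9)
      (mul_nonneg (half_pos hlam0).le hδ)
    linarith
  set y : ℝ := u ^ (-(1 / 3 : ℝ)) with hy
  have hy0 : 0 < y := Real.rpow_pos_of_pos hu0 _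
  have hyinv : u ^ (1 / 3 : ℝ) = y⁻¹ := by rw [hy, Real.rpow_neg hu0.le, inv_inv]
  have herr : 9 / u * ∑ i, 2 * B * ‖d (t + 1) i ω - (1 / (n : ℝ)) • gradient (f i) (x t i ω)‖
      ≤ 9 / u * ∑ i, B * (y + u ^ (1 / 3 : ℝ)
        * ‖d (t + 1) i ω - (1 / (n : ℝ)) • gradient (f i) (x t i ω)‖ ^ 2) := by
    refine mul_le_mul_of_nonneg_left (Finset.sum_le_sum fun i _ => ?_) (by positivity)
    rw [hyinv, mul_comm 2 B, mul_assoc]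
    refine mul_le_mul_of_nonneg_left ?_ hB
    set r := ‖d (t + 1) i ω - (1 / (n : ℝ)) • gradient (f i) (x t i ω)‖
    have h1 : y + y⁻¹ * r ^ 2 - 2 * r = (y - r) ^ 2 / y := by field_simp; ring
    have h2 : 0 ≤ (y - r) ^ 2 / y := by positivity
    linarith
  have hquad : (9 / u) ^ 2 * (4 * L * B ^ 2 + 8 * n * (lam0 * √u) * B ^ 2)
      ≤ 81 * (4 * L * B ^ 2 + 8 * n * lam0 * B ^ 2) * (y / u) := by
    have hy1 : 1 / u ≤ y := by
      rw [one_div, ← Real.rpow_neg_one]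
      exact Real.rpow_le_rpow_of_exponent_le (by linarith) (by norm_num)
    have hy2 : √u / u ≤ y := by
      rw [Real.sqrt_eq_rpow, ← Real.rpow_sub_one hu0.ne']
      exact Real.rpow_le_rpow_of_exponent_le (by linarith) (by norm_num)
    have h1 : 81 * (4 * L * B ^ 2) * (1 / u / u) ≤ 81 * (4 * L * B ^ 2) * (y / u) :=
      mul_le_mul_of_nonneg_left (div_le_div_of_nonneg_right hy1 hu0.le) (by positivity)
    have h2 : 81 * (8 * n * lam0 * B ^ 2) * (√u / u / u) ≤ 81 * (8 * n * lam0 * B ^ 2) * (y / u) :=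
      mul_le_mul_of_nonneg_left (div_le_div_of_nonneg_right hy2 hu0.le) (by positivity)
    have e : (9 / u) ^ 2 * (4 * L * B ^ 2 + 8 * n * (lam0 * √u) * B ^ 2)
        = 81 * (4 * L * B ^ 2) * (1 / u / u) + 81 * (8 * n * lam0 * B ^ 2) * (√u / u / u) := by
      field_simp; ring
    rw [e]
    linarith
  linarith

theorem norm_xbar_le (hn : 0 < n) (h : IsFedFWStoRun D ℓ P (fun t => 9 / ((t : ℝ) + 8)) lam ρ
      x₁ μ ℱ ξ x d g s xbar)
    (hD : ∀ y ∈ D, ‖y‖ ≤ B) (hx₁ : ∀ i, ‖x₁ i‖ ≤ B) {t : ℕ} (ht : 1 ≤ t) (ω : Ω) :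
    ‖xbar t ω‖ ≤ B := by
  have hn0 : (n : ℝ) ≠ 0 := by exact_mod_cast hn.ne'
  rw [h.xbar_eq ht, norm_smul, Real.norm_of_nonneg (by positivity)]
  calc 1 / (n : ℝ) * ‖∑ i, x t i ω‖ ≤ 1 / (n : ℝ) * ∑ i : Fin n, B :=
        mul_le_mul_of_nonneg_left (norm_sum_le_of_le _ fun i _ =>
          h.norm_x_le stepSize_nonneg stepSize_le_one hD hx₁ ht i ω) (by positivity)
    _ = B := by
        rw [Finset.sum_const, Finset.card_univ, Fintype.card_fin, nsmul_eq_mul]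
        field_simp

theorem measurable_xbar (h : IsFedFWStoRun D ℓ P (fun t => 9 / ((t : ℝ) + 8)) lam ρ
      x₁ μ ℱ ξ x d g s xbar) {t : ℕ} (ht : 1 ≤ t) : Measurable (xbar t) := by
  rw [show xbar t = fun ω => (1 / (n : ℝ)) • ∑ i, x t i ω from funext fun ω => h.xbar_eq ht ω]
  have hsum : Measurable fun ω => ∑ i, x t i ω := Finset.measurable_fun_sum _ fun i _ =>
    (h.measurable_x ht i).mono (ℱ.le t) le_rfl
  exact hsum.const_smul (1 / (n : ℝ))

theorem integrable_penalizedGap [IsFiniteMeasure μ] (hn : 0 < n)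
    (h : IsFedFWStoRun D ℓ P (fun t => 9 / ((t : ℝ) + 8)) lam ρ x₁ μ ℱ ξ x d g s xbar)
    (hD : ∀ y ∈ D, ‖y‖ ≤ B) (hx₁ : ∀ i, ‖x₁ i‖ ≤ B) (hf : ∀ i, Continuous (f i))
    {t : ℕ} (ht : 1 ≤ t) (r : ℝ) :
    Integrable (fun ω => penalizedGap f z r (fun i => x t i ω) (xbar t ω)) μ := by
  have hmx := fun i => (h.measurable_x ht i).mono (ℱ.le t) le_rfl
  have hx := fun i ω => h.norm_x_le stepSize_nonneg stepSize_le_one hD hx₁ ht i ω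
  have h1 : ∀ i, Integrable (fun ω => f i (x t i ω)) μ := fun i =>
    integrable_continuous_comp_of_norm_le (hf i) (hmx i) (hx i)
  have h2 : ∀ i, Integrable (fun ω => ‖x t i ω - xbar t ω‖ ^ 2) μ := fun i => by
    refine integrable_continuous_comp_of_norm_le (φ := fun v => ‖v‖ ^ 2) (by fun_prop)
      ((hmx i).sub (h.measurable_xbar ht)) (B := B + B) fun ω => ?_
    exact (norm_sub_le _ _).trans (add_le_add (hx i ω) (h.norm_xbar_le hn hD hx₁ ht ω))
  exact (((integrable_finsetSum _ fun i _ => h1 i).const_mul _).sub (integrable_const _)).add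
    ((integrable_finsetSum _ fun i _ => h2 i).const_mul _)

theorem integral_penalizedGap_succ_le [IsProbabilityMeasure μ] (hn : 0 < n)
    (h : IsFedFWStoRun D ℓ P (fun t => 9 / ((t : ℝ) + 8)) (fun t => lam0 * √((t : ℝ) + 8))
      (fun t => 4 / ((t : ℝ) + 7) ^ ((2 : ℝ) / 3)) x₁ μ ℱ ξ x d g s xbar)
    (hlam0 : 0 < lam0) (hD : ∀ y ∈ D, ‖y‖ ≤ B) (hx₁ : ∀ i, ‖x₁ i‖ ≤ B) (hz : z ∈ D)
    (hf : ∀ i, ConvexOn ℝ Set.univ (f i)) (hs : ∀ i, LSmooth L (f i))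
    (hℓ : ∀ i, IsStochasticLoss (f i) (ℓ i) (P i))
    (hσ : ∀ i, BoundedVariance (f i) (ℓ i) (P i) σ)
    (hQ : Q = 9 * σ ^ 2 + 27 * L ^ 2 * B ^ 2) {t : ℕ} (ht : 1 ≤ t) :
    ∫ ω, penalizedGap f z (lam0 * √((t : ℝ) + 8)) (fun i => x (t + 1) i ω) (xbar (t + 1) ω) ∂μ
      ≤ (1 - 9 / ((t : ℝ) + 8)) *
          ∫ ω, penalizedGap f z (lam0 * √((t : ℝ) + 7)) (fun i => x t i ω) (xbar t ω) ∂μ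
        + (9 * n * B * (1 + Q) + 81 * (4 * L * B ^ 2 + 8 * n * lam0 * B ^ 2))
          * (((t : ℝ) + 8) ^ (-(1 / 3 : ℝ)) / ((t : ℝ) + 8)) := by
  have hcont := fun i => (hs i).differentiable.continuous
  have hB : 0 ≤ B := (norm_nonneg z).trans (hD z hz)
  have hu0 : 0 < (t : ℝ) + 8 := by positivity
  have hV := fun i => h.integral_gradError_sq_le hD hx₁ i (hℓ i) (hσ i) (hs i).lipschitz hQ ht
  have hI1 := (h.integrable_penalizedGap (z := z) hn hD hx₁ hcont ht (lam0 * √((t : ℝ) + 7))).const_mul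
    (1 - 9 / ((t : ℝ) + 8))
  have hIi : ∀ i, Integrable (fun ω => B * (((t : ℝ) + 8) ^ (-(1 / 3 : ℝ))
      + ((t : ℝ) + 8) ^ (1 / 3 : ℝ)
        * ‖d (t + 1) i ω - (1 / (n : ℝ)) • gradient (f i) (x t i ω)‖ ^ 2)) μ := fun i => ((integrable_const (μ := μ) (((t : ℝ) + 8) ^ (-(1 / 3 : ℝ)))).add
    ((hV i).1.const_mul (((t : ℝ) + 8) ^ (1 / 3 : ℝ)))).const_mul B
  have hI2 := (integrable_finsetSum Finset.univ fun i _ => hIi i).const_mul (9 / ((t : ℝ) + 8))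
  have hle := integral_mono
    (h.integrable_penalizedGap (z := z) hn hD hx₁ hcont (by omega : 1 ≤ t + 1) (lam0 * √((t : ℝ) + 8)))
    ((hI1.add hI2).add (integrable_const (81 * (4 * L * B ^ 2 + 8 * n * lam0 * B ^ 2)
          * (((t : ℝ) + 8) ^ (-(1 / 3 : ℝ)) / ((t : ℝ) + 8)))))
    (fun ω => h.penalizedGap_succ_le hn hlam0 hD hx₁ hz hf hs ht ω)
  refine hle.trans ?_
  rw [integral_add' (hI1.add hI2) (integrable_const _), integral_add' hI1 hI2, integral_const_mul,
    integral_const_mul, integral_finsetSum _ fun i _ => hIi i]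
  simp only [integral_const, probReal_univ, smul_eq_mul, one_mul]
  set u : ℝ := (t : ℝ) + 8
  set y : ℝ := u ^ (-(1 / 3 : ℝ)) with hy
  have hy0 : 0 < y := Real.rpow_pos_of_pos hu0 _
  have hterm : ∀ i, ∫ ω, B * (y + u ^ (1 / 3 : ℝ)
      * ‖d (t + 1) i ω - (1 / (n : ℝ)) • gradient (f i) (x t i ω)‖ ^ 2) ∂μ
      ≤ B * ((1 + Q) * y) := by
    intro i
    rw [integral_const_mul, integral_add (integrable_const _) ((hV i).1.const_mul _),
      integral_const_mul]
    simp only [integral_const, probReal_univ, smul_eq_mul, one_mul]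
    refine mul_le_mul_of_nonneg_left ?_ hB
    have h1 := mul_le_mul_of_nonneg_left (hV i).2 (Real.rpow_nonneg hu0.le (1 / 3))
    have h2 : u ^ (1 / 3 : ℝ) * (Q * u ^ (-(2 / 3 : ℝ))) = Q * y := by
      rw [mul_left_comm, ← Real.rpow_add hu0, hy]; norm_num
    linarith
  have hsum := Finset.sum_le_sum fun i (_ : i ∈ Finset.univ) => hterm i
  rw [Finset.sum_const, Finset.card_univ, Fintype.card_fin, nsmul_eq_mul] at hsum
  have h9 := mul_le_mul_of_nonneg_left hsum (by positivity : 0 ≤ 9 / u)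
  have e : 9 / u * (n * (B * ((1 + Q) * y))) = 9 * n * B * (1 + Q) * (y / u) := by ring
  linarith

end IsFedFWStoRun

/-! ### Choice of the constant and conclusion. -/

theorem theorem3 {p n : ℕ} (hn : 0 < n)
    (D : Set (EuclideanSpace ℝ (Fin p))) (hDconv : Convex ℝ D) (hDcomp : IsCompact D)
    (L : NNReal) (f : Fin n → EuclideanSpace ℝ (Fin p) → ℝ)
    (hf_smooth : ∀ i, LSmooth L (f i)) (hf_convex : ∀ i, ConvexOn ℝ Set.univ (f i))
    (σ lam0 : ℝ) (hlam0 : 0 < lam0)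
    (x₁ : Fin n → EuclideanSpace ℝ (Fin p))
    (xstar : EuclideanSpace ℝ (Fin p)) (hxstar_mem : xstar ∈ D)
    (hxstar_min : IsMinOn (globalLoss f) D xstar) :
    ∃ C : ℝ,
      ∀ (S : Fin n → Type*) [∀ i, MeasurableSpace (S i)]
        (ℓ : (i : Fin n) → EuclideanSpace ℝ (Fin p) → S i → ℝ)
        (P : (i : Fin n) → Measure (S i)),
        (∀ i, IsStochasticLoss (f i) (ℓ i) (P i)) →
        (∀ i, BoundedVariance (f i) (ℓ i) (P i) σ) →
      ∀ (Ω : Type*) [mΩ : MeasurableSpace Ω] (μ : Measure Ω) [IsProbabilityMeasure μ]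
        (ℱ : Filtration ℕ mΩ)
        (ξ : ℕ → (i : Fin n) → Ω → S i)
        (x d g s : ℕ → Fin n → Ω → EuclideanSpace ℝ (Fin p))
        (xbar : ℕ → Ω → EuclideanSpace ℝ (Fin p)),
        IsFedFWStoRun D ℓ P
          (fun t => 9 / ((t : ℝ) + 8))
          (fun t => lam0 * Real.sqrt ((t : ℝ) + 8))
          (fun t => 4 / ((t : ℝ) + 7) ^ ((2 : ℝ) / 3))
          x₁ μ ℱ ξ x d g s xbar →
      ∀ t : ℕ, 1 ≤ t →
        Integrable (fun ω => globalLoss f (xbar t ω)) μ ∧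
        (∫ ω, globalLoss f (xbar t ω) ∂μ) - globalLoss f xstar
          ≤ C * (t : ℝ) ^ (-(1 : ℝ) / 3) := by

  obtain ⟨B₀, hB₀⟩ := hDcomp.isBounded.exists_norm_le
  -- The initial models need not lie in `D`, so their norms enter the radius.
  set B : ℝ := B₀ + ∑ i, ‖x₁ i‖
  have hD : ∀ y ∈ D, ‖y‖ ≤ B := fun y hy =>
    (hB₀ y hy).trans (le_add_of_nonneg_right (Finset.sum_nonneg fun i _ => norm_nonneg _))
  have hx₁ : ∀ i, ‖x₁ i‖ ≤ B := fun i =>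
    (Finset.single_le_sum (fun j _ => norm_nonneg (x₁ j)) (Finset.mem_univ i)).trans
      (le_add_of_nonneg_left ((norm_nonneg _).trans (hB₀ xstar hxstar_mem)))
  have hB : 0 ≤ B := (norm_nonneg _).trans (hD xstar hxstar_mem)
  set G : ℝ := ∑ i, ‖gradient (f i) 0‖ + L * B
  have hG : ∀ i y, ‖y‖ ≤ B → ‖gradient (f i) y‖ ≤ G := by
    intro i y hy
    have h1 := (hf_smooth i).lipschitz.dist_le_mul y 0
    rw [dist_eq_norm, dist_zero_right] at h1
    have h2 := norm_le_norm_add_norm_sub' (gradient (f i) y) (gradient (f i) 0)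
    have h3 := Finset.single_le_sum (fun j _ => norm_nonneg (gradient (f j) 0)) (Finset.mem_univ i)
    have h4 := mul_le_mul_of_nonneg_left hy L.coe_nonneg
    simp only [G]
    linarith
  set Q : ℝ := 9 * σ ^ 2 + 27 * L ^ 2 * B ^ 2 with hQ
  have hQ0 : 0 ≤ Q := by positivity
  set c : ℝ := 9 * n * B * (1 + Q) + 81 * (4 * L * B ^ 2 + 8 * n * lam0 * B ^ 2)
  have hc : 0 ≤ c := by positivity
  set H : ℝ := penalizedGap f xstar (lam0 * √8) x₁ ((1 / (n : ℝ)) • ∑ i, x₁ i)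
  -- The first summand covers the potential at `t = 1`, which may be negative, hence `|H|`; the
  -- second gives `c ≤ 8 * K`.
  set K : ℝ := |H| * 9 ^ (1 / 3 : ℝ) + c / 8
  have hK : 0 ≤ K := by positivity
  refine ⟨K + G ^ 2 / (2 * lam0), ?_⟩
  intro S _ ℓ P hℓ hσ Ω _ μ _ ℱ ξ x d g s xbar h t ht
  have hcont : ∀ i, Continuous (f i) := fun i => (hf_smooth i).differentiable.continuous
  have hFint : Integrable (fun ω => globalLoss f (xbar t ω)) μ :=
    integrable_continuous_comp_of_norm_le
      (continuous_const.mul (continuous_finsetSum _ fun i _ => hcont i)) (h.measurable_xbar ht)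
      (h.norm_xbar_le hn hD hx₁ ht)
  refine ⟨hFint, ?_⟩
  have hrate := le_mul_rpow_of_recursion (a := fun t => ∫ ω, penalizedGap f xstar
      (lam0 * √((t : ℝ) + 7)) (fun i => x t i ω) (xbar t ω) ∂μ) (c := c) hK
    (by simp only [K]
        linarith [mul_nonneg (abs_nonneg H) (Real.rpow_nonneg (by norm_num : (0 : ℝ) ≤ 9) (1 / 3))])
    (by simp only [h.x_init, h.xbar_init, integral_const, probReal_univ, smul_eq_mul, one_mul]
        rw [show ((1 : ℕ) : ℝ) + 7 = 8 by norm_num]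
        have e : |H| * (9 : ℝ) ^ (1 / 3 : ℝ) * 9 ^ (-(1 / 3 : ℝ)) = |H| := by
          rw [mul_assoc, ← Real.rpow_add (by norm_num)]
          norm_num
        have h9 : 0 ≤ c / 8 * (9 : ℝ) ^ (-(1 / 3 : ℝ)) := by positivity
        calc H ≤ |H| := le_abs_self H
          _ ≤ K * 9 ^ (-(1 / 3 : ℝ)) := by
            simp only [K]
            rw [add_mul, e]
            linarith)
    (fun t ht => by
      have := h.integral_penalizedGap_succ_le hn hlam0 hD hx₁ hxstar_mem hf_convex hf_smooth hℓ hσ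
        hQ ht
      rw [show ((t + 1 : ℕ) : ℝ) + 7 = (t : ℝ) + 8 by push_cast; ring]
      exact this) ht
  have ht1 : (1 : ℝ) ≤ t := by exact_mod_cast ht
  have ht0 : (0 : ℝ) < t := by linarith
  have hlam : 0 < lam0 * √((t : ℝ) + 7) := by positivity
  have hgap := integral_mono (hFint.sub (integrable_const (globalLoss f xstar)))
    ((h.integrable_penalizedGap (z := xstar) hn hD hx₁ hcont ht (lam0 * √((t : ℝ) + 7))).add
      (integrable_const (G ^ 2 / (2 * (lam0 * √((t : ℝ) + 7))))))
    (fun ω => globalLoss_sub_le_penalizedGap hn hf_convex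
      (fun i => (hf_smooth i).differentiable) hlam
      (fun i => hG i _ (h.norm_xbar_le hn hD hx₁ ht ω)))
  rw [integral_sub' hFint (integrable_const _), integral_add'
    (h.integrable_penalizedGap hn hD hx₁ hcont ht _) (integrable_const _)] at hgap
  simp only [integral_const, probReal_univ, smul_eq_mul, one_mul] at hgap
  have hexp : (-(1 : ℝ) / 3) = -(1 / 3 : ℝ) := by ring
  rw [hexp]
  have h1 : K * ((t : ℝ) + 8) ^ (-(1 / 3 : ℝ)) ≤ K * (t : ℝ) ^ (-(1 / 3 : ℝ)) :=
    mul_le_mul_of_nonneg_left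
      (Real.rpow_le_rpow_of_nonpos ht0 (by linarith) (by norm_num)) hK
  have h2 : G ^ 2 / (2 * (lam0 * √((t : ℝ) + 7)))
      ≤ G ^ 2 / (2 * lam0) * (t : ℝ) ^ (-(1 / 3 : ℝ)) := by
    have hs : (t : ℝ) ^ (1 / 3 : ℝ) ≤ √((t : ℝ) + 7) := by
      refine le_trans ?_ (Real.sqrt_le_sqrt (by linarith : (t : ℝ) ≤ t + 7))
      rw [Real.sqrt_eq_rpow]
      exact Real.rpow_le_rpow_of_exponent_le ht1 (by norm_num)
    rw [Real.rpow_neg ht0.le, ← div_eq_mul_inv, div_div, mul_assoc]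
    have : 0 < (t : ℝ) ^ (1 / 3 : ℝ) := Real.rpow_pos_of_pos ht0 _
    gcongr
  rw [add_mul]
  linarith
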